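/- **Setting.** Fix $n\ge 3$. The torus $T$ of size $n$ has vertex set $V=\{0,\dots,n-1\}^2$, where $(i,j)$ is adjacent to $(i,(j+1)\bmod n)$ and to $((i+1)\bmod n,j)$; let $d_{uv}$ be the distance in $T$. Independently, each $u\in V$ chooses one vertex $v\ne u$, with probability $Z_u d_{uv}^{-2}$, where $Z_u=\big(\sum_{w\ne u}d_{uw}^{-2}\big)^{-1}$. The random graph $G$ is $T$ together with the edge $\{u,v\}$ for each $u\in V$ and the vertex $v$ chosen by $u$ (without parallel edges). **Algorithm.** A four-cycle rooted in $u$ is a cycle $(u,a,b,c)$ of four distinct vertices. Four of these with the same root $u$ form a lattice pattern if they can be written as $(u,a_{k-1},b_k,a_k)$, up to direction, for $k\in\mathbb Z/4$, with the nine vertices $u,a_0,\dots,a_3,b_0,\dots,b_3$ distinct. The long-range edges removing algorithm LRERA takes only the graph $G$ as input. For every vertex $u$ it lists by a depth-first search all four-cycles of $G$ rooted in $u$ (up to direction), tests each set of four of them for being a lattice pattern (following the shared edges at $u$ from one cycle to the next), and collects in $E''_u$ the edges incident to $u$ of the cycles in all sets that pass. It declares $u$ *detected* if $|E''_u|=4$,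 and in that case discards all edges of $G$ incident to $u$ that are not in $E''_u$. Its output is the graph $G'$ of the edges not discarded, together with the set of detected vertices. **Lemma.** Let $D_u$ be the event that LRERA detects $u$, and let $E_u$ be the event that some four-cycle rooted in $u$ is in $G$ but not in $T$. Then: 1. For all $n\ge3$ and every outcome of the choices, the edges of $G'$ incident to a detected vertex $u$ are exactly the edges of $T$ incident to $u$. 2. For all $n\ge3$ and all $u\in V$, $\Pr(D_u)\ge 1-4\Pr(E_u)$. 3. The expected number of vertices that LRERA detects is $|V|\,(1-O(1/\log n))$; that is, there is a constant $K>0$ such that for all $n\ge3$ $$|V|\Big(1-\frac{K}{\log n}\Big)\;\le\;\mathbb E\big[\#\{u\in V: u\text{ is detected}\}\big]\;\le\;|V| .$$ -/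

import Mathlib

open MeasureTheory

namespace UTSW

/-! ### Four-cycles, lattice patterns and the long-range edges removing algorithm

The algorithm receives only a graph on a finite vertex set; it has no access to positions on the
torus.  Wherever the pseudocode leaves an order or a choice open ("for each", "choose an arbitrary",
"find"), the order of `Finset.toList`, about which nothing is known, is used. -/

section Algorithm

variable {V : Type*} [Fintype V] [DecidableEq V]

/-- `(u, a, b, c)` is a four-cycle of `H` rooted in `u`, composed by four distinct vertices. -/
def IsFourCycle (H : SimpleGraph V) (u a b c : V) : Prop :=
  u ≠ a ∧ u ≠ b ∧ u ≠ c ∧ a ≠ b ∧ a ≠ c ∧ b ≠ c ∧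
    H.Adj u a ∧ H.Adj a b ∧ H.Adj b c ∧ H.Adj c u

open Classical in
/-- The set of neighbours of `v` in `G`. -/
noncomputable def nbrs (G : SimpleGraph V) (v : V) : Finset V :=
  Finset.univ.filter fun w => G.Adj v w

open Classical in
/-- Depth-first search, limited to depth four, for the four-cycles rooted in `u`
(each cycle is found in both directions). -/
noncomputable def recursiveFourCyclesSearch (G : SimpleGraph V) (u : V) :
    Finset (V × V × V × V) :=
  (nbrs G u \ {u}).biUnion fun v₂ =>
    (nbrs G v₂ \ {u, v₂}).biUnion fun v₃ =>
      (nbrs G v₃ \ {u, v₂, v₃}).biUnion fun v₄ =>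
        if u ∈ nbrs G v₄ then {(u, v₂, v₃, v₄)} else ∅

/-- Duplication removing: a cycle is kept unless its reversal has already been kept. -/
noncomputable def removeDuplicates (S : Finset (V × V × V × V)) : Finset (V × V × V × V) :=
  S.toList.foldl
    (fun R c => if (c.1, c.2.2.2, c.2.2.1, c.2.1) ∉ R then insert c R else R) ∅

/-- Four-cycles search. -/
noncomputable def fourCyclesSearch (G : SimpleGraph V) (u : V) : Finset (V × V × V × V) :=
  removeDuplicates (recursiveFourCyclesSearch G u)

/-- The loop of the lattice pattern recognition algorithm: `k` iterations are left, `L` holds the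
cycles not yet used, `S` the vertices already seen, and `a` is the current shared neighbour of the
root.  The value is the last `a`, or `none` if the loop returns `false`. -/
def latticePatternLoop : ℕ → List (V × V × V × V) → Finset V → V → Option V
  | 0, _, _, a => some a
  | k + 1, L, S, a =>
    match L.find? (fun c => decide (c.2.1 = a ∨ c.2.2.2 = a)) with
    | none => none
    | some c =>
      if (({c.2.1, c.2.2.1, c.2.2.2} : Finset V) \ {a}) ∩ S ≠ ∅ then none
      else latticePatternLoop k (L.erase c) (S ∪ {c.2.1, c.2.2.1, c.2.2.2})
        (if c.2.1 = a then c.2.2.2 else c.2.1)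

/-- The lattice pattern recognition algorithm on a list of cycles, whose first member is the
arbitrarily chosen cycle `C⁰`. -/
def recognizeList : List (V × V × V × V) → Bool
  | [] => false
  | c :: L =>
    decide (latticePatternLoop 3 L {c.1, c.2.2.1, c.2.2.2} c.2.2.2 = some c.2.1)

/-- The lattice pattern recognition algorithm. -/
noncomputable def recognizesLatticePattern (C : Finset (V × V × V × V)) : Bool :=
  recognizeList C.toList

/-- The four edges of a four-cycle. -/
def cycleEdges (c : V × V × V × V) : Finset (Sym2 V) :=
  {s(c.1, c.2.1), s(c.2.1, c.2.2.1), s(c.2.2.1, c.2.2.2), s(c.2.2.2, c.1)}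

/-- The set `E''` computed for the vertex `u`: the edges incident to `u` of the cycles in all
recognized four-element sets of four-cycles rooted in `u`. -/
noncomputable def rootEdges (G : SimpleGraph V) (u : V) : Finset (Sym2 V) :=
  (((fourCyclesSearch G u).powersetCard 4).filter
      fun C => recognizesLatticePattern C = true).biUnion fun C =>
    C.biUnion fun c => (cycleEdges c).filter fun e => u ∈ e

/-- The result of the long-range edges removing algorithm: a graph on the same vertices, and the
attribute `detected` of each vertex. -/
structure RemovalOutput (V : Type*) where
  graph : SimpleGraph V
  detected : V → Prop

/-- The long-range edges removing algorithm.  A vertex `u` is detected if `|E''| = 4`, and an edge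
of `G` is dropped if it is incident to a detected vertex `u` and not in the set `E''` of `u`. -/
noncomputable def removeLongRangeEdges (G : SimpleGraph V) : RemovalOutput V where
  graph := SimpleGraph.fromEdgeSet
    {e | e ∈ G.edgeSet ∧ ∀ u, (rootEdges G u).card = 4 → u ∈ e → e ∈ rootEdges G u}
  detected u := (rootEdges G u).card = 4

end Algorithm

/-! ### The undirected toroidal small world model -/

/-- The `n²` vertices of the torus of size `n`. -/
abbrev Vertex (n : ℕ) : Type := Fin n × Fin n

/-- The two-dimensional undirected torus of size `n`: `(i, j)` is joined to `(i, j + 1 mod n)` and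
to `(i + 1 mod n, j)`. -/
def torus (n : ℕ) : SimpleGraph (Vertex n) :=
  SimpleGraph.fromRel fun p q =>
    (q.1 = p.1 ∧ q.2.val = (p.2.val + 1) % n) ∨ (q.1.val = (p.1.val + 1) % n ∧ q.2 = p.2)

/-- The normalizing factor `Z_u`. -/
noncomputable def normalizingFactor (n : ℕ) (u : Vertex n) : ℝ :=
  (∑ w ∈ Finset.univ.erase u, (((torus n).dist u w : ℝ) ^ 2)⁻¹)⁻¹

/-- The probability that `u` chooses `v`: the inverse second-power distribution. -/
noncomputable def choiceProb (n : ℕ) (u v : Vertex n) : ℝ :=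
  if v = u then 0 else normalizingFactor n u * (((torus n).dist u v : ℝ) ^ 2)⁻¹

/-- The law of the vertex chosen by `u`. -/
noncomputable def choiceLaw (n : ℕ) (u : Vertex n) : Measure (Vertex n) :=
  ∑ v, ENNReal.ofReal (choiceProb n u v) • Measure.dirac v

/-- The joint law of all choices, made independently by the vertices. -/
noncomputable def choicesLaw (n : ℕ) : Measure (Vertex n → Vertex n) :=
  Measure.pi (choiceLaw n)

/-- The small world graph `G` in which each vertex `u` has chosen `c u`: the torus together with
the edges `{u, c u}`. -/
def smallWorld (n : ℕ) (c : Vertex n → Vertex n) : SimpleGraph (Vertex n) :=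
  torus n ⊔ SimpleGraph.fromRel fun u v => c u = v

/-- The event `D_u` that the algorithm detects `u`. -/
def detectedEvent (n : ℕ) (u : Vertex n) : Set (Vertex n → Vertex n) :=
  {c | (removeLongRangeEdges (smallWorld n c)).detected u}

/-- The event `E_u` that some four-cycle rooted in `u` is in `G` but not in the torus. -/
def extraCycleEvent (n : ℕ) (u : Vertex n) : Set (Vertex n → Vertex n) :=
  {c | ∃ v₂ v₃ v₄, IsFourCycle (smallWorld n c) u v₂ v₃ v₄ ∧ ¬ IsFourCycle (torus n) u v₂ v₃ v₄}

/-- The number of vertices that the algorithm detects. -/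
noncomputable def detectedCount (n : ℕ) (c : Vertex n → Vertex n) : ℕ :=
  {u | (removeLongRangeEdges (smallWorld n c)).detected u}.ncard

end UTSW

/-!
Three observations carry the proof.

*The torus edges are always collected.* For `n ≥ 3` the four unit squares of the torus around `u`
have nine distinct vertices, so they form a lattice pattern in every graph that contains the torus.
The search finds each of them (in one direction), and the recognition accepts the set of the four
whatever the order of the list and the directions of its members (`recognizeList_eq_true`): once the
first cycle is fixed, exactly one remaining cycle passes through the current neighbour of the root.
Hence the collected set always contains the four torus edges at `u`, and `u` is detected exactly
when it contains nothing else (`card_rootEdges_eq_four_iff`). At a detected vertex the algorithm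
therefore keeps exactly the torus edges; a torus edge is not dropped by its other endpoint either.

*No extra cycle, no failure.* If every four-cycle rooted in `u` lies in the torus, then only torus
edges are collected, and `u` is detected. So `Pr(D_u) ≥ 1 - Pr(E_u)`.

*Extra cycles are rare.* By translation invariance the choice probabilities are symmetric, and by
comparison with the harmonic series each of them is at most `4 / log n` (`choiceProb_le`). Distinct
long-range edges are negatively correlated (`choicesLaw_real_joined_le`): different vertices choose
independently, and a vertex cannot choose two targets. An extra four-cycle through `u` has a
long-range edge, whose probability is `O(1 / log n)`; each remaining edge `{x, y}` is charged the
weight `1 + 2 p(x, y)` if it is in the torus and `2 p(x, y)` otherwise. At each vertex these weights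
sum to `4 + 2 = 6`, and the three remaining edges form paths starting at `u`, so summing over all
cycles gives a factor `6 ^ 3` for each position of the long-range edge
(`choicesLaw_real_extraCycleEvent_le`). Linearity of expectation finishes the proof.
-/

namespace UTSW

/-! ### The lattice pattern recognition algorithm -/

section Algorithm

variable {V : Type*}

/-- The tuple `c` is the cycle `(u, a, b, a')`, in one of its two directions. -/
def IsUndirectedCycle (u a b a' : V) (c : V × V × V × V) : Prop :=
  c = (u, a, b, a') ∨ c = (u, a', b, a)

theorem IsUndirectedCycle.symm {u a b a' : V} {c : V × V × V × V}
    (h : IsUndirectedCycle u a b a' c) : IsUndirectedCycle u a' b a c :=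
  Or.symm h

theorem nodup_rotate {u a₀ a₁ a₂ a₃ b₀ b₁ b₂ b₃ : V}
    (h : [u, a₀, a₁, a₂, a₃, b₀, b₁, b₂, b₃].Nodup) :
    [u, a₁, a₂, a₃, a₀, b₁, b₂, b₃, b₀].Nodup := by
  simp only [List.nodup_cons, List.mem_cons, List.not_mem_nil, or_false, not_or,
    not_false_eq_true, List.nodup_nil, and_true] at h ⊢
  grind

theorem nodup_reflect {u a₀ a₁ a₂ a₃ b₀ b₁ b₂ b₃ : V}
    (h : [u, a₀, a₁, a₂, a₃, b₀, b₁, b₂, b₃].Nodup) :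
    [u, a₁, a₀, a₃, a₂, b₀, b₃, b₂, b₁].Nodup := by
  simp only [List.nodup_cons, List.mem_cons, List.not_mem_nil, or_false, not_or,
    not_false_eq_true, List.nodup_nil, and_true] at h ⊢
  grind

variable [DecidableEq V]

/-- One forced step of the loop: if `c` is the only remaining cycle through the current neighbour
`a` of the root and its other two vertices are new, the loop crosses `c` from `a` to `a'`. -/
theorem latticePatternLoop_succ_eq {u a b a' : V} {c : V × V × V × V}
    {L M : List (V × V × V × V)} {S : Finset V} (k : ℕ)
    (hL : L.Perm (c :: M)) (hc : IsUndirectedCycle u a b a' c)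
    (hM : ∀ d ∈ M, d.2.1 ≠ a ∧ d.2.2.2 ≠ a) (haa' : a ≠ a') (hb : b ∉ S) (ha' : a' ∉ S) :
    latticePatternLoop (k + 1) L S a =
      latticePatternLoop k (L.erase c) (S ∪ {a, b, a'}) a' := by
  have hfind : L.find? (fun c => decide (c.2.1 = a ∨ c.2.2.2 = a)) = some c := by
    cases h : L.find? (fun c => decide (c.2.1 = a ∨ c.2.2.2 = a)) with
    | none =>
      rw [List.find?_eq_none] at h
      have := h c (hL.mem_iff.2 (by simp))
      rcases hc with rfl | rfl <;> simp at this
    | some d =>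
      have h1 := List.find?_some h
      have h2 := hL.mem_iff.1 (List.mem_of_find?_eq_some h)
      simp only [decide_eq_true_eq] at h1
      rcases List.mem_cons.1 h2 with rfl | h2
      · rfl
      · have := hM d h2
        tauto
  rw [latticePatternLoop, hfind]
  have hdisj : (({c.2.1, c.2.2.1, c.2.2.2} : Finset V) \ {a}) ∩ S = ∅ := by
    ext x
    simp only [Finset.mem_inter, Finset.mem_sdiff, Finset.mem_insert, Finset.mem_singleton,
      Finset.notMem_empty, iff_false]
    rcases hc with rfl | rfl <;> rintro ⟨⟨rfl | rfl | rfl, h⟩, hS⟩ <;> tauto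
  simp only [hdisj, ne_eq, not_true_eq_false, if_false]
  rcases hc with rfl | rfl
  · simp
  · have : ({a', b, a} : Finset V) = {a, b, a'} := by
      ext x; simp only [Finset.mem_insert, Finset.mem_singleton]; tauto
    simp [haa'.symm, this]

/-- Once the first cycle and its direction are fixed, the loop has no choice: the current neighbour
of the root lies on exactly one of the remaining cycles, so the walk around the root is forced,
whatever the order of the list and the directions of its members. -/
theorem recognizeList_cons_eq_true {u a₀ a₁ a₂ a₃ b₀ b₁ b₂ b₃ : V} {c₁ c₂ c₃ : V × V × V × V}
    {L : List (V × V × V × V)} (hnd : [u, a₀, a₁, a₂, a₃, b₀, b₁, b₂, b₃].Nodup)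
    (hL : L.Perm [c₁, c₂, c₃]) (h₁ : IsUndirectedCycle u a₁ b₁ a₂ c₁)
    (h₂ : IsUndirectedCycle u a₂ b₂ a₃ c₂) (h₃ : IsUndirectedCycle u a₃ b₃ a₀ c₃) :
    recognizeList ((u, a₀, b₀, a₁) :: L) = true := by
  simp only [List.nodup_cons, List.mem_cons, List.not_mem_nil, or_false, not_or,
    not_false_eq_true, List.nodup_nil, and_true] at hnd
  have hL₁ : (L.erase c₁).Perm [c₂, c₃] := by simpa using hL.erase c₁
  have hL₂ : ((L.erase c₁).erase c₂).Perm [c₃] := by simpa using hL₁.erase c₂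
  rw [recognizeList, decide_eq_true_eq]
  dsimp only
  rw [latticePatternLoop_succ_eq 2 hL h₁ ?_ ?_ ?_ ?_,
    latticePatternLoop_succ_eq 1 hL₁ h₂ ?_ ?_ ?_ ?_,
    latticePatternLoop_succ_eq 0 hL₂ h₃ ?_ ?_ ?_ ?_, latticePatternLoop]
  all_goals
    first
    | (intro d hd
       simp only [List.mem_cons, List.not_mem_nil, or_false] at hd
       rcases h₂ with h₂ | h₂ <;> rcases h₃ with h₃ | h₃ <;> grind)
    | grind

theorem recognizeList_eq_true {u a₀ a₁ a₂ a₃ b₀ b₁ b₂ b₃ : V} {c₀ c₁ c₂ c₃ : V × V × V × V}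
    {L : List (V × V × V × V)} (hnd : [u, a₀, a₁, a₂, a₃, b₀, b₁, b₂, b₃].Nodup)
    (hL : L.Perm [c₀, c₁, c₂, c₃]) (h₀ : IsUndirectedCycle u a₀ b₀ a₁ c₀)
    (h₁ : IsUndirectedCycle u a₁ b₁ a₂ c₁) (h₂ : IsUndirectedCycle u a₂ b₂ a₃ c₂)
    (h₃ : IsUndirectedCycle u a₃ b₃ a₀ c₃) :
    recognizeList L = true := by
  -- the case in which `c₀` comes first in the list; if it is listed against the rotation, the
  -- loop goes around the root backwards, which is the same statement for the reflected pattern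
  have key : ∀ {a₀ a₁ a₂ a₃ b₀ b₁ b₂ b₃ : V} {c₀ c₁ c₂ c₃ : V × V × V × V}
      {L : List (V × V × V × V)}, [u, a₀, a₁, a₂, a₃, b₀, b₁, b₂, b₃].Nodup →
      L.Perm [c₁, c₂, c₃] → IsUndirectedCycle u a₀ b₀ a₁ c₀ → IsUndirectedCycle u a₁ b₁ a₂ c₁ →
      IsUndirectedCycle u a₂ b₂ a₃ c₂ → IsUndirectedCycle u a₃ b₃ a₀ c₃ →
      recognizeList (c₀ :: L) = true := by
    intro a₀ a₁ a₂ a₃ b₀ b₁ b₂ b₃ c₀ c₁ c₂ c₃ L hnd hL h₀ h₁ h₂ h₃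
    rcases h₀ with rfl | rfl
    · exact recognizeList_cons_eq_true hnd hL h₁ h₂ h₃
    · have hL' : L.Perm [c₃, c₂, c₁] := hL.trans (List.reverse_perm [c₃, c₂, c₁])
      exact recognizeList_cons_eq_true (nodup_reflect hnd) hL' h₃.symm h₂.symm h₁.symm
  obtain _ | ⟨c, M⟩ := L
  · simp at hL
  have hmem : c ∈ [c₀, c₁, c₂, c₃] := hL.mem_iff.1 (by simp)
  simp only [List.mem_cons, List.not_mem_nil, or_false] at hmem
  have hp₁ : [c₀, c₁, c₂, c₃].Perm [c₁, c₂, c₃, c₀] := (List.perm_append_comm (l₁ := [c₀]))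
  have hp₂ : [c₀, c₁, c₂, c₃].Perm [c₂, c₃, c₀, c₁] := (List.perm_append_comm (l₁ := [c₀, c₁]))
  have hp₃ : [c₀, c₁, c₂, c₃].Perm [c₃, c₀, c₁, c₂] := (List.perm_append_comm (l₁ := [c₀, c₁, c₂]))
  rcases hmem with rfl | rfl | rfl | rfl
  · exact key hnd (List.perm_cons _ |>.1 hL) h₀ h₁ h₂ h₃
  · exact key (nodup_rotate hnd) (List.perm_cons _ |>.1 (hL.trans hp₁)) h₁ h₂ h₃ h₀
  · exact key (nodup_rotate (nodup_rotate hnd)) (List.perm_cons _ |>.1 (hL.trans hp₂)) h₂ h₃ h₀ h₁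
  · exact key (nodup_rotate (nodup_rotate (nodup_rotate hnd)))
      (List.perm_cons _ |>.1 (hL.trans hp₃)) h₃ h₀ h₁ h₂

/-! ### The four-cycles search -/

theorem removeDuplicates_subset (S : Finset (V × V × V × V)) : removeDuplicates S ⊆ S := by
  have key : ∀ (l : List (V × V × V × V)) (R : Finset (V × V × V × V)),
      (∀ c ∈ l, c ∈ S) → R ⊆ S →
      l.foldl (fun R c => if (c.1, c.2.2.2, c.2.2.1, c.2.1) ∉ R then insert c R else R) R ⊆ S := by
    intro l
    induction l with
    | nil => intro R _ hR; simpa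
    | cons d l ih =>
      intro R hl hR
      rw [List.foldl_cons]
      refine ih _ (fun c hc => hl c (by simp [hc])) ?_
      split_ifs
      · exact hR
      · exact Finset.insert_subset (hl d (by simp)) hR
  exact key _ _ (fun c hc => Finset.mem_toList.1 hc) (Finset.empty_subset _)

/-- Duplication removing keeps every cycle of the list, in one direction at least. -/
theorem mem_removeDuplicates_or {S : Finset (V × V × V × V)} {c : V × V × V × V} (hc : c ∈ S) :
    c ∈ removeDuplicates S ∨ (c.1, c.2.2.2, c.2.2.1, c.2.1) ∈ removeDuplicates S := by
  have mono : ∀ (l : List (V × V × V × V)) (R : Finset (V × V × V × V)),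
      R ⊆ l.foldl
        (fun R c => if (c.1, c.2.2.2, c.2.2.1, c.2.1) ∉ R then insert c R else R) R := by
    intro l
    induction l with
    | nil => intro R; simp
    | cons d l ih =>
      intro R
      rw [List.foldl_cons]
      refine Finset.Subset.trans ?_ (ih _)
      split_ifs
      · exact Finset.Subset.refl _
      · exact Finset.subset_insert _ _
  have key : ∀ (l : List (V × V × V × V)) (R : Finset (V × V × V × V)), c ∈ l →
      c ∈ l.foldl (fun R c => if (c.1, c.2.2.2, c.2.2.1, c.2.1) ∉ R then insert c R else R) R ∨
      (c.1, c.2.2.2, c.2.2.1, c.2.1) ∈ l.foldl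
        (fun R c => if (c.1, c.2.2.2, c.2.2.1, c.2.1) ∉ R then insert c R else R) R := by
    intro l
    induction l with
    | nil => intro R h; simp at h
    | cons d l ih =>
      intro R h
      rw [List.foldl_cons]
      rcases List.mem_cons.1 h with rfl | h
      · by_cases hR : (c.1, c.2.2.2, c.2.2.1, c.2.1) ∈ R
        · right
          simp only [hR, not_true_eq_false, if_false]
          exact mono _ _ hR
        · left
          simp only [hR, not_false_eq_true, if_true]
          exact mono _ _ (Finset.mem_insert_self _ _)
      · exact ih _ h
  exact key _ _ (Finset.mem_toList.2 hc)

variable [Fintype V]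

theorem mem_recursiveFourCyclesSearch {G : SimpleGraph V} {u v a b c : V} :
    (v, a, b, c) ∈ recursiveFourCyclesSearch G u ↔ v = u ∧ IsFourCycle G u a b c := by
  classical
  simp only [recursiveFourCyclesSearch, nbrs, IsFourCycle, Finset.mem_biUnion, Finset.mem_sdiff,
    Finset.mem_filter, Finset.mem_univ, true_and, Finset.mem_insert, Finset.mem_singleton, not_or]
  constructor
  · rintro ⟨x, ⟨h1, h2⟩, y, ⟨h3, h4, h5⟩, z, ⟨h6, h7, h8, h9⟩, h⟩
    split_ifs at h with hu
    · simp only [Finset.mem_singleton, Prod.mk.injEq] at h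
      obtain ⟨rfl, rfl, rfl, rfl⟩ := h
      grind
    · simp at h
  · rintro ⟨rfl, h1, h2, h3, h4, h5, h6, h7, h8, h9, h10⟩
    exact ⟨a, ⟨h7, h1.symm⟩, b, ⟨h8, h2.symm, h4.symm⟩, c, ⟨h9, h3.symm, h5.symm, h6.symm⟩,
      by simp [h10]⟩

theorem exists_mem_fourCyclesSearch {G : SimpleGraph V} {u a b c : V}
    (h : IsFourCycle G u a b c) : ∃ d ∈ fourCyclesSearch G u, IsUndirectedCycle u a b c d := by
  rcases mem_removeDuplicates_or (mem_recursiveFourCyclesSearch.2 ⟨rfl, h⟩) with h | h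
  · exact ⟨_, h, Or.inl rfl⟩
  · exact ⟨_, h, Or.inr rfl⟩

/-! ### The edges collected at a vertex -/

/-- A collected edge joins the root to one of its two neighbours on some four-cycle. -/
theorem exists_isFourCycle_of_mem_rootEdges {G : SimpleGraph V} {u : V} {e : Sym2 V}
    (he : e ∈ rootEdges G u) :
    ∃ a b c, IsFourCycle G u a b c ∧ (e = s(u, a) ∨ e = s(u, c)) := by
  simp only [rootEdges, Finset.mem_biUnion, Finset.mem_filter, Finset.mem_powersetCard] at he
  obtain ⟨C, ⟨⟨hC, -⟩, -⟩, ⟨v, a, b, c⟩, hd, hed, hu⟩ := he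
  obtain ⟨rfl, h⟩ :=
    mem_recursiveFourCyclesSearch.1 (removeDuplicates_subset _ (hC hd))
  refine ⟨a, b, c, h, ?_⟩
  obtain ⟨h1, h2, h3, -⟩ := h
  simp only [cycleEdges, Finset.mem_insert, Finset.mem_singleton] at hed
  rcases hed with rfl | rfl | rfl | rfl
  · exact Or.inl rfl
  · simp [h1, h2] at hu
  · simp [h2, h3] at hu
  · exact Or.inr Sym2.eq_swap

/-- Every lattice pattern of the graph passes the recognition, so its four edges at the root are
collected. -/
theorem mem_rootEdges_of_lattice {G : SimpleGraph V} {u a₀ a₁ a₂ a₃ b₀ b₁ b₂ b₃ : V}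
    (hnd : [u, a₀, a₁, a₂, a₃, b₀, b₁, b₂, b₃].Nodup)
    (h₀ : IsFourCycle G u a₀ b₀ a₁) (h₁ : IsFourCycle G u a₁ b₁ a₂)
    (h₂ : IsFourCycle G u a₂ b₂ a₃) (h₃ : IsFourCycle G u a₃ b₃ a₀)
    {v : V} (hv : v = a₀ ∨ v = a₁ ∨ v = a₂ ∨ v = a₃) : s(u, v) ∈ rootEdges G u := by
  obtain ⟨c₀, hm₀, hc₀⟩ := exists_mem_fourCyclesSearch h₀
  obtain ⟨c₁, hm₁, hc₁⟩ := exists_mem_fourCyclesSearch h₁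
  obtain ⟨c₂, hm₂, hc₂⟩ := exists_mem_fourCyclesSearch h₂
  obtain ⟨c₃, hm₃, hc₃⟩ := exists_mem_fourCyclesSearch h₃
  -- the third coordinates `b₀, …, b₃` tell the four tuples apart
  have hcnd : [c₀, c₁, c₂, c₃].Nodup := by
    have hb : ([c₀, c₁, c₂, c₃].map fun c => c.2.2.1) = [b₀, b₁, b₂, b₃] := by
      have : ∀ {a b a' : V} {c}, IsUndirectedCycle u a b a' c → c.2.2.1 = b := by
        rintro a b a' c (rfl | rfl) <;> rfl
      simp [this hc₀, this hc₁, this hc₂, this hc₃]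
    refine List.Nodup.of_map (fun c => c.2.2.1) ?_
    rw [hb]
    simp only [List.nodup_cons, List.mem_cons, not_or] at hnd ⊢
    grind
  have hlist : ([c₀, c₁, c₂, c₃].toFinset.toList).Perm [c₀, c₁, c₂, c₃] :=
    List.toFinset_toList hcnd
  have hrec : recognizesLatticePattern [c₀, c₁, c₂, c₃].toFinset = true :=
    recognizeList_eq_true hnd hlist hc₀ hc₁ hc₂ hc₃
  have hsub : [c₀, c₁, c₂, c₃].toFinset ⊆ fourCyclesSearch G u := by
    intro c hc
    simp only [List.mem_toFinset, List.mem_cons, List.not_mem_nil, or_false] at hc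
    rcases hc with rfl | rfl | rfl | rfl <;> assumption
  have hcard : [c₀, c₁, c₂, c₃].toFinset.card = 4 := List.toFinset_card_of_nodup hcnd
  have hedge : ∀ {a b a' : V} {c}, IsUndirectedCycle u a b a' c → s(u, a) ∈ cycleEdges c := by
    rintro a b a' c (rfl | rfl) <;> simp [cycleEdges, Sym2.eq_swap]
  have main : ∀ c ∈ [c₀, c₁, c₂, c₃], s(u, v) ∈ cycleEdges c → s(u, v) ∈ rootEdges G u := by
    intro c hc hcv
    simp only [rootEdges, Finset.mem_biUnion, Finset.mem_filter, Finset.mem_powersetCard]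
    exact ⟨_, ⟨⟨hsub, hcard⟩, hrec⟩, c, List.mem_toFinset.2 hc, hcv, by simp⟩
  rcases hv with rfl | rfl | rfl | rfl
  · exact main c₀ (by simp) (hedge hc₀)
  · exact main c₁ (by simp) (hedge hc₁)
  · exact main c₂ (by simp) (hedge hc₂)
  · exact main c₃ (by simp) (hedge hc₃)

end Algorithm

/-! ### Neighbours in the torus -/

section Torus

variable {n : ℕ}

/-- The edges of the torus at `u`. -/
noncomputable def torusEdges (n : ℕ) (u : Vertex n) : Finset (Sym2 (Vertex n)) :=
  (nbrs (torus n) u).image fun v => s(u, v)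

theorem mem_torusEdges {u v : Vertex n} : s(u, v) ∈ torusEdges n u ↔ (torus n).Adj u v := by
  classical
  simp only [torusEdges, nbrs, Finset.mem_image, Finset.mem_filter, Finset.mem_univ, true_and,
    Sym2.congr_right, exists_eq_right]

variable [NeZero n]

theorem torus_adj_iff {p q : Vertex n} :
    (torus n).Adj p q ↔ p ≠ q ∧
      ((q = p + (0, 1) ∨ q = p + (1, 0)) ∨ (p = q + (0, 1) ∨ p = q + (1, 0))) := by
  have h : ∀ x y : Fin n, y.val = (x.val + 1) % n ↔ y = x + 1 := by
    intro x y
    rw [Fin.ext_iff, Fin.val_add, Fin.val_one', Nat.add_mod_mod]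
  simp only [torus, SimpleGraph.fromRel_adj, h, Prod.ext_iff, Prod.fst_add, Prod.snd_add, add_zero]

theorem torus_adj_add_right {p q t : Vertex n} :
    (torus n).Adj (p + t) (q + t) ↔ (torus n).Adj p q := by
  simp only [torus_adj_iff, add_right_comm _ t, add_left_inj, ne_eq]

theorem fin_one_ne_zero_of_three_le (hn : 3 ≤ n) : (1 : Fin n) ≠ 0 := by
  rw [Ne, Fin.ext_iff, Fin.val_one', Fin.val_zero, Nat.mod_eq_of_lt (by omega)]
  omega

theorem fin_one_add_one_ne_zero_of_three_le (hn : 3 ≤ n) : (1 + 1 : Fin n) ≠ 0 := by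
  rw [Ne, Fin.ext_iff, Fin.val_add, Fin.val_one', Fin.val_zero,
    Nat.mod_eq_of_lt (a := 1) (by omega), Nat.mod_eq_of_lt (by omega)]
  omega

/-- Size at least three is what keeps the nine vertices around `u` apart. -/
theorem nodup_lattice (hn : 3 ≤ n) (u : Vertex n) :
    [u, u + (1, 0), u + (0, 1), u - (1, 0), u - (0, 1), u + (1, 0) + (0, 1), u + (0, 1) - (1, 0),
      u - (1, 0) - (0, 1), u + (1, 0) - (0, 1)].Nodup := by
  have h1 : ∀ x : Fin n, x + 1 ≠ x := fun x => by
    simpa using fin_one_ne_zero_of_three_le hn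
  have h2 : ∀ x : Fin n, x - 1 ≠ x := fun x => by
    simpa [sub_eq_self] using fin_one_ne_zero_of_three_le hn
  have h3 : ∀ x : Fin n, x + 1 ≠ x - 1 := fun x h => by
    refine fin_one_add_one_ne_zero_of_three_le hn ?_
    have := congrArg (fun y => y + 1 - x) h
    simpa [add_assoc] using this
  obtain ⟨i, j⟩ := u
  simp [h1, h2, h3, fun x => (h1 x).symm, fun x => (h2 x).symm, fun x => (h3 x).symm]

theorem torus_adj_iff_of_three_le (hn : 3 ≤ n) {u v : Vertex n} :
    (torus n).Adj u v ↔ v = u + (1, 0) ∨ v = u + (0, 1) ∨ v = u - (1, 0) ∨ v = u - (0, 1) := by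
  have h := nodup_lattice hn u
  simp only [List.nodup_cons, List.mem_cons, not_or] at h
  rw [torus_adj_iff, eq_sub_iff_add_eq, eq_sub_iff_add_eq, @eq_comm _ u, @eq_comm _ u]
  constructor
  · tauto
  -- the condition `u ≠ v` is automatic for `n ≥ 3`
  · intro hv
    refine ⟨?_, by tauto⟩
    rintro rfl
    have h1 := h.1
    rw [← eq_sub_iff_add_eq, ← eq_sub_iff_add_eq] at hv
    tauto

open Classical in
theorem card_torus_neighbors (hn : 3 ≤ n) (u : Vertex n) :
    (Finset.univ.filter fun v => (torus n).Adj u v).card = 4 := by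
  have h := nodup_lattice hn u
  have : (Finset.univ.filter fun v => (torus n).Adj u v) =
      [u + (1, 0), u + (0, 1), u - (1, 0), u - (0, 1)].toFinset := by
    ext v
    simp [torus_adj_iff_of_three_le hn]
  rw [this, List.toFinset_card_of_nodup]
  · rfl
  · simp only [List.nodup_cons, List.mem_cons, not_or] at h ⊢
    tauto

/-! ### Detection -/

/-- In every graph containing the torus, the four torus edges at a vertex are collected. -/
theorem mem_rootEdges_of_torus_adj (hn : 3 ≤ n) {G : SimpleGraph (Vertex n)} (hG : torus n ≤ G)
    {u v : Vertex n} (h : (torus n).Adj u v) : s(u, v) ∈ rootEdges G u := by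
  have hnd := nodup_lattice hn u
  have h' := hnd
  simp only [List.nodup_cons, List.mem_cons, List.not_mem_nil, or_false, not_or] at h'
  have hadj : ∀ {p q : Vertex n},
      q = p + (1, 0) ∨ q = p + (0, 1) ∨ q = p - (1, 0) ∨ q = p - (0, 1) → G.Adj p q :=
    fun h => hG ((torus_adj_iff_of_three_le hn).2 h)
  refine mem_rootEdges_of_lattice hnd ?_ ?_ ?_ ?_ ((torus_adj_iff_of_three_le hn).1 h)
  · refine ⟨by tauto, by tauto, by tauto, by tauto, by tauto, by tauto, ?_, ?_, ?_, ?_⟩ <;>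
      apply hadj
    · exact Or.inl rfl
    · exact Or.inr (Or.inl rfl)
    · right; right; left; abel
    · right; right; right; abel
  · refine ⟨by tauto, by tauto, by tauto, by tauto, by tauto, by tauto, ?_, ?_, ?_, ?_⟩ <;>
      apply hadj
    · right; left; rfl
    · right; right; left; rfl
    · right; right; right; abel
    · left; abel
  · refine ⟨by tauto, by tauto, by tauto, by tauto, by tauto, by tauto, ?_, ?_, ?_, ?_⟩ <;>
      apply hadj
    · right; right; left; rfl
    · right; right; right; rfl
    · left; abel
    · right; left; abel
  · refine ⟨by tauto, by tauto, by tauto, by tauto, by tauto, by tauto, ?_, ?_, ?_, ?_⟩ <;>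
      apply hadj
    · right; right; right; rfl
    · left; abel
    · right; left; abel
    · right; right; left; abel

theorem card_torusEdges (hn : 3 ≤ n) (u : Vertex n) : (torusEdges n u).card = 4 := by
  rw [torusEdges, Finset.card_image_of_injective _ (fun v w h => Sym2.congr_right.1 h)]
  exact card_torus_neighbors hn u

theorem torusEdges_subset_rootEdges (hn : 3 ≤ n) {G : SimpleGraph (Vertex n)} (hG : torus n ≤ G)
    (u : Vertex n) : torusEdges n u ⊆ rootEdges G u := by
  classical
  intro e he
  simp only [torusEdges, nbrs, Finset.mem_image, Finset.mem_filter] at he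
  obtain ⟨v, ⟨-, hv⟩, rfl⟩ := he
  exact mem_rootEdges_of_torus_adj hn hG hv

/-- The four torus edges are always among the collected ones, so a vertex is detected exactly when
nothing else is collected. -/
theorem card_rootEdges_eq_four_iff (hn : 3 ≤ n) {G : SimpleGraph (Vertex n)} (hG : torus n ≤ G)
    (u : Vertex n) : (rootEdges G u).card = 4 ↔ rootEdges G u = torusEdges n u := by
  constructor
  · intro h
    exact (Finset.eq_of_subset_of_card_le (torusEdges_subset_rootEdges hn hG u)
      (by rw [h, card_torusEdges hn])).symm
  · intro h
    rw [h, card_torusEdges hn]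

theorem removeLongRangeEdges_adj_iff (hn : 3 ≤ n) {G : SimpleGraph (Vertex n)} (hG : torus n ≤ G)
    {u : Vertex n} (hu : (removeLongRangeEdges G).detected u) (v : Vertex n) :
    (removeLongRangeEdges G).graph.Adj u v ↔ (torus n).Adj u v := by
  have hu' := (card_rootEdges_eq_four_iff hn hG u).1 hu
  simp only [removeLongRangeEdges, SimpleGraph.fromEdgeSet_adj, Set.mem_ofPred_eq]
  constructor
  · rintro ⟨⟨-, h⟩, -⟩
    have := h u hu (by simp)
    rwa [hu', mem_torusEdges] at this
  · intro h
    refine ⟨⟨hG h, fun w hw hwe => ?_⟩, h.ne⟩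
    rw [(card_rootEdges_eq_four_iff hn hG w).1 hw]
    rcases Sym2.mem_iff.1 hwe with rfl | rfl
    · exact mem_torusEdges.2 h
    · rw [Sym2.eq_swap]
      exact mem_torusEdges.2 h.symm

theorem detected_of_forall_isFourCycle (hn : 3 ≤ n) {G : SimpleGraph (Vertex n)} (hG : torus n ≤ G)
    {u : Vertex n} (h : ∀ a b c, IsFourCycle G u a b c → IsFourCycle (torus n) u a b c) :
    (removeLongRangeEdges G).detected u := by
  refine (card_rootEdges_eq_four_iff hn hG u).2
    (Finset.Subset.antisymm ?_ (torusEdges_subset_rootEdges hn hG u))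
  intro e he
  obtain ⟨a, b, c, hc, rfl | rfl⟩ := exists_isFourCycle_of_mem_rootEdges he
  · obtain ⟨-, -, -, -, -, -, h1, -⟩ := h a b c hc
    exact mem_torusEdges.2 h1
  · obtain ⟨-, -, -, -, -, -, -, -, -, h1⟩ := h a b c hc
    exact mem_torusEdges.2 h1.symm

theorem compl_extraCycleEvent_subset_detectedEvent (hn : 3 ≤ n) (u : Vertex n) :
    (extraCycleEvent n u)ᶜ ⊆ detectedEvent n u := by
  intro c hc
  refine detected_of_forall_isFourCycle hn le_sup_left fun v₂ v₃ v₄ h => ?_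
  by_contra h'
  exact hc ⟨v₂, v₃, v₄, h, h'⟩

end Torus

/-! ### Distances in the torus and the inverse-square law -/

section Distance

variable {n : ℕ}

/-- The junk value `0⁻¹ = 0` at `w = u` makes the restriction `w ≠ u` superfluous. -/
theorem normalizingFactor_eq (u : Vertex n) :
    normalizingFactor n u = (∑ w, (((torus n).dist u w : ℝ) ^ 2)⁻¹)⁻¹ := by
  rw [normalizingFactor, ← Finset.add_sum_erase Finset.univ _ (Finset.mem_univ u)]
  simp

theorem choiceProb_eq (u v : Vertex n) :
    choiceProb n u v = normalizingFactor n u * (((torus n).dist u v : ℝ) ^ 2)⁻¹ := by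
  rw [choiceProb]
  split_ifs with h
  · simp [h]
  · rfl

theorem choiceProb_nonneg (u v : Vertex n) : 0 ≤ choiceProb n u v := by
  rw [choiceProb_eq, normalizingFactor_eq]
  positivity

variable [NeZero n]

theorem exists_walk_nsmul {e : Vertex n} (he : ∀ u : Vertex n, (torus n).Adj u (u + e)) (k : ℕ)
    (u : Vertex n) : ∃ w : (torus n).Walk u (u + k • e), w.length = k := by
  induction k with
  | zero => exact ⟨(SimpleGraph.Walk.nil : (torus n).Walk u u).copy rfl (by simp), by simp⟩
  | succ k ih =>
    obtain ⟨w, hw⟩ := ih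
    exact ⟨(w.concat (he _)).copy rfl (by rw [succ_nsmul, add_assoc]), by simp [hw]⟩

theorem val_nsmul_one (k : ℕ) : (k • (1 : Fin n)).val = k % n := by
  induction k with
  | zero => simp
  | succ k ih => rw [succ_nsmul, Fin.val_add, ih, Fin.val_one', ← Nat.add_mod]

theorem exists_walk_add (hn : 3 ≤ n) (u t : Vertex n) :
    ∃ w : (torus n).Walk u (u + t), w.length = t.1.val + t.2.val := by
  obtain ⟨w₁, h₁⟩ := exists_walk_nsmul (e := ((1, 0) : Vertex n))
    (fun u => (torus_adj_iff_of_three_le hn).2 (Or.inl rfl)) t.1.val u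
  obtain ⟨w₂, h₂⟩ := exists_walk_nsmul (e := ((0, 1) : Vertex n))
    (fun u => (torus_adj_iff_of_three_le hn).2 (Or.inr (Or.inl rfl))) t.2.val
    (u + t.1.val • ((1, 0) : Vertex n))
  have ht : t.1.val • ((1, 0) : Vertex n) + t.2.val • ((0, 1) : Vertex n) = t := by
    have h : ∀ x : Fin n, x.val • (1 : Fin n) = x := fun x => by
      rw [Fin.ext_iff, val_nsmul_one, Nat.mod_eq_of_lt x.isLt]
    ext1 <;> simp [h]
  exact ⟨(w₁.append w₂).copy rfl (by rw [add_assoc, ht]), by simp [h₁, h₂]⟩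

theorem torus_reachable (hn : 3 ≤ n) (u v : Vertex n) : (torus n).Reachable u v := by
  obtain ⟨w, -⟩ := exists_walk_add hn u (v - u)
  exact ⟨w.copy rfl (by simp)⟩

theorem torus_dist_add_le (hn : 3 ≤ n) (u t : Vertex n) :
    (torus n).dist u (u + t) ≤ t.1.val + t.2.val := by
  obtain ⟨w, hw⟩ := exists_walk_add hn u t
  exact hw ▸ SimpleGraph.dist_le w

theorem torus_dist_add_right (hn : 3 ≤ n) (u v t : Vertex n) :
    (torus n).dist (u + t) (v + t) = (torus n).dist u v := by
  have key : ∀ u v t : Vertex n, (torus n).dist (u + t) (v + t) ≤ (torus n).dist u v := by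
    intro u v t
    obtain ⟨w, hw⟩ := (torus_reachable hn u v).exists_walk_length_eq_dist
    let f : torus n →g torus n := ⟨fun p => p + t, fun h => torus_adj_add_right.2 h⟩
    rw [← hw, ← SimpleGraph.Walk.length_map f w]
    exact SimpleGraph.dist_le (w.map f)
  refine le_antisymm (key u v t) ?_
  simpa using key (u + t) (v + t) (-t)

theorem normalizingFactor_eq_normalizingFactor (hn : 3 ≤ n) (u v : Vertex n) :
    normalizingFactor n u = normalizingFactor n v := by
  rw [normalizingFactor_eq, normalizingFactor_eq, 
    ← Equiv.sum_comp (Equiv.addRight (v - u)) fun w => (((torus n).dist v w : ℝ) ^ 2)⁻¹]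
  congr 1
  refine Finset.sum_congr rfl fun w _ => ?_
  have := torus_dist_add_right hn u w (v - u)
  rw [add_sub_cancel] at this
  rw [Equiv.coe_addRight, this]

theorem choiceProb_comm (hn : 3 ≤ n) (u v : Vertex n) : choiceProb n u v = choiceProb n v u := by
  rw [choiceProb_eq, choiceProb_eq, SimpleGraph.dist_comm,
    normalizingFactor_eq_normalizingFactor hn u v]

/-- The `i + 1` displacements `(i, j)` with `j ≤ i` have length at most `2 i`, so they contribute
at least `1 / (4 i)` to the sum: the sum dominates a quarter of the harmonic series. -/
theorem log_div_four_le_sum_dist (hn : 3 ≤ n) (u : Vertex n) :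
    Real.log n / 4 ≤ ∑ w, (((torus n).dist u w : ℝ) ^ 2)⁻¹ := by
  have h1 : ∑ t : Vertex n, (((t.1.val : ℝ) + t.2.val) ^ 2)⁻¹ ≤
      ∑ w, (((torus n).dist u w : ℝ) ^ 2)⁻¹ := by
    rw [← Equiv.sum_comp (Equiv.addLeft u) fun w => (((torus n).dist u w : ℝ) ^ 2)⁻¹]
    refine Finset.sum_le_sum fun t _ => ?_
    rw [Equiv.coe_addLeft]
    by_cases ht : t = 0
    · simp [ht]
    · have hpos : 0 < (torus n).dist u (u + t) :=
        (torus_reachable hn _ _).pos_dist_of_ne (by simpa using fun h => ht h)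
      have hle : ((torus n).dist u (u + t) : ℝ) ≤ t.1.val + t.2.val := by
        exact_mod_cast torus_dist_add_le hn u t
      have : (0 : ℝ) < (torus n).dist u (u + t) := by exact_mod_cast hpos
      gcongr
  have h2 : ∑ t : Vertex n, (((t.1.val : ℝ) + t.2.val) ^ 2)⁻¹ =
      ∑ i ∈ Finset.range n, ∑ j ∈ Finset.range n, (((i : ℝ) + j) ^ 2)⁻¹ := by
    rw [Fintype.sum_prod_type,
      ← Fin.sum_univ_eq_sum_range (fun i => ∑ j ∈ Finset.range n, (((i : ℝ) + j) ^ 2)⁻¹)]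
    refine Finset.sum_congr rfl fun i _ => ?_
    rw [← Fin.sum_univ_eq_sum_range (fun j => (((i.val : ℝ) + j) ^ 2)⁻¹)]
  have h3 : ∑ i ∈ Finset.range n, (i : ℝ)⁻¹ / 4 ≤
      ∑ i ∈ Finset.range n, ∑ j ∈ Finset.range n, (((i : ℝ) + j) ^ 2)⁻¹ := by
    refine Finset.sum_le_sum fun i hi => ?_
    have hsub : Finset.range (i + 1) ⊆ Finset.range n :=
      Finset.range_subset_range.2 (Finset.mem_range.1 hi)
    refine le_trans ?_ (Finset.sum_le_sum_of_subset_of_nonneg hsub fun _ _ _ => by positivity)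
    rcases Nat.eq_zero_or_pos i with rfl | hi0
    · simp
    have hi' : (0 : ℝ) < i := by exact_mod_cast hi0
    calc (i : ℝ)⁻¹ / 4 ≤ (i + 1 : ℕ) • ((2 * (i : ℝ)) ^ 2)⁻¹ := by
          rw [nsmul_eq_mul, ← sub_nonneg]
          have : ((i + 1 : ℕ) : ℝ) * ((2 * (i : ℝ)) ^ 2)⁻¹ - (i : ℝ)⁻¹ / 4 =
              ((i : ℝ) ^ 2)⁻¹ / 4 := by
            push_cast
            field_simp
            ring
          rw [this]
          positivity
      _ = ∑ j ∈ Finset.range (i + 1), ((2 * (i : ℝ)) ^ 2)⁻¹ := by simp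
      _ ≤ ∑ j ∈ Finset.range (i + 1), (((i : ℝ) + j) ^ 2)⁻¹ := by
          refine Finset.sum_le_sum fun j hj => ?_
          have : (j : ℝ) ≤ i := by exact_mod_cast Nat.lt_succ_iff.1 (Finset.mem_range.1 hj)
          gcongr
          linarith
  have h4 : Real.log n ≤ ∑ i ∈ Finset.range n, (i : ℝ)⁻¹ := by
    obtain ⟨m, rfl⟩ : ∃ m, n = m + 1 := ⟨n - 1, by omega⟩
    have := log_add_one_le_harmonic m
    rw [Finset.sum_range_succ']
    simpa [harmonic] using this
  rw [← Finset.sum_div] at h3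
  linarith

theorem sum_choiceProb (hn : 3 ≤ n) (u : Vertex n) : ∑ v, choiceProb n u v = 1 := by
  have hlog : 0 < Real.log n := Real.log_pos (by exact_mod_cast (by omega : 1 < n))
  have h := log_div_four_le_sum_dist hn u
  simp_rw [choiceProb_eq, ← Finset.mul_sum, normalizingFactor_eq]
  exact inv_mul_cancel₀ (by linarith)

theorem choiceProb_le (hn : 3 ≤ n) (u v : Vertex n) : choiceProb n u v ≤ 4 / Real.log n := by
  have hlog : 0 < Real.log n := Real.log_pos (by exact_mod_cast (by omega : 1 < n))
  have hZ : normalizingFactor n u ≤ 4 / Real.log n := by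
    rw [normalizingFactor_eq, ← inv_div]
    exact inv_anti₀ (by positivity) (log_div_four_le_sum_dist hn u)
  have hd : (((torus n).dist u v : ℝ) ^ 2)⁻¹ ≤ 1 := by
    exact_mod_cast Nat.cast_inv_le_one (α := ℝ) ((torus n).dist u v ^ 2)
  rw [choiceProb_eq]
  calc _ ≤ 4 / Real.log n * 1 := by gcongr
    _ = _ := mul_one _

end Distance

/-! ### The joint law of the choices -/

section Probability

variable {n : ℕ}

theorem choiceLaw_apply (u : Vertex n) (s : Set (Vertex n)) :
    choiceLaw n u s = ∑ v, ENNReal.ofReal (choiceProb n u v) * s.indicator 1 v := by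
  simp [choiceLaw, Measure.finsetSum_apply]

theorem choiceLaw_real_singleton (u v : Vertex n) :
    (choiceLaw n u).real {v} = choiceProb n u v := by
  rw [Measure.real, choiceLaw_apply, Finset.sum_eq_single v]
  · simp [choiceProb_nonneg]
  · intro w _ hw
    simp [hw]
  · simp

variable [NeZero n]

theorem isProbabilityMeasure_choiceLaw (hn : 3 ≤ n) (u : Vertex n) :
    IsProbabilityMeasure (choiceLaw n u) := by
  refine ⟨?_⟩
  rw [choiceLaw_apply]
  simp only [Set.indicator_univ, Pi.one_apply, mul_one]
  rw [← ENNReal.ofReal_sum_of_nonneg fun v _ => choiceProb_nonneg u v, sum_choiceProb hn,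
    ENNReal.ofReal_one]

theorem isProbabilityMeasure_choicesLaw (hn : 3 ≤ n) : IsProbabilityMeasure (choicesLaw n) := by
  have := isProbabilityMeasure_choiceLaw hn
  rw [choicesLaw]
  infer_instance

/-- Distinct prescribed choices `s j ↦ t j` are realized jointly with at most the product of their
probabilities: choices of different vertices are independent, and two different choices of the same
vertex exclude each other. -/
theorem choicesLaw_real_forall_eq_le (hn : 3 ≤ n) {ι : Type*} (J : Finset ι) (s t : ι → Vertex n)
    (hinj : Set.InjOn (fun j => (s j, t j)) J) :
    (choicesLaw n).real {c | ∀ j ∈ J, c (s j) = t j} ≤ ∏ j ∈ J, choiceProb n (s j) (t j) := by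
  classical
  have := isProbabilityMeasure_choiceLaw hn
  have hset : {c : Vertex n → Vertex n | ∀ j ∈ J, c (s j) = t j} =
      Set.univ.pi fun u => {v | ∀ j ∈ J, s j = u → v = t j} := by
    ext c
    simp only [Set.mem_ofPred_eq, Set.mem_pi, Set.mem_univ, true_imp_iff]
    exact ⟨fun h u j hj hu => hu ▸ h j hj, fun h j hj => h _ j hj rfl⟩
  rw [hset, choicesLaw, Measure.real, Measure.pi_pi, ENNReal.toReal_prod,
    ← Finset.prod_fiberwise J s]
  refine Finset.prod_le_prod (fun _ _ => ENNReal.toReal_nonneg) fun u _ => ?_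
  change (choiceLaw n u).real _ ≤ _
  rcases (J.filter fun j => s j = u).eq_empty_or_nonempty with h | ⟨j, hj⟩
  · rw [h, Finset.prod_empty]
    exact measureReal_le_one
  obtain ⟨hjJ, hju⟩ := Finset.mem_filter.1 hj
  by_cases huniq : ∀ i ∈ J.filter fun j => s j = u, i = j
  · have : (J.filter fun j => s j = u) = {j} := Finset.eq_singleton_iff_unique_mem.2 ⟨hj, huniq⟩
    rw [this, Finset.prod_singleton, hju, ← choiceLaw_real_singleton]
    exact measureReal_mono fun v hv => hv j hjJ hju
  · push Not at huniq
    obtain ⟨i, hi, hij⟩ := huniq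
    obtain ⟨hiJ, hiu⟩ := Finset.mem_filter.1 hi
    have hempty : {v : Vertex n | ∀ j ∈ J, s j = u → v = t j} = ∅ := by
      refine Set.eq_empty_of_forall_notMem fun v hv => hij (hinj hiJ hjJ ?_)
      exact Prod.ext (hiu.trans hju.symm) ((hv i hiJ hiu).symm.trans (hv j hjJ hju))
    rw [hempty, measureReal_empty]
    exact Finset.prod_nonneg fun _ _ => choiceProb_nonneg _ _

/-- The long-range edges are negatively correlated: distinct vertex pairs are all joined by choices
with at most the product of the (union bounds of the) individual probabilities. -/
theorem choicesLaw_real_joined_le (hn : 3 ≤ n) {ι : Type*} (J : Finset ι) (x y : ι → Vertex n)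
    (hinj : Set.InjOn (fun j => s(x j, y j)) J) :
    (choicesLaw n).real {c | ∀ j ∈ J, c (x j) = y j ∨ c (y j) = x j} ≤
      ∏ j ∈ J, 2 * choiceProb n (x j) (y j) := by
  classical
  have := isProbabilityMeasure_choicesLaw hn
  -- `K` collects the pairs in which `x j` is the one who chooses
  let s : Finset ι → ι → Vertex n := fun K j => if j ∈ K then x j else y j
  let t : Finset ι → ι → Vertex n := fun K j => if j ∈ K then y j else x j
  have hsub : {c : Vertex n → Vertex n | ∀ j ∈ J, c (x j) = y j ∨ c (y j) = x j} ⊆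
      ⋃ K ∈ J.powerset, {c | ∀ j ∈ J, c (s K j) = t K j} := by
    intro c hc
    simp only [Set.mem_iUnion]
    refine ⟨J.filter fun j => c (x j) = y j, Finset.mem_powerset.2 (Finset.filter_subset _ _), ?_⟩
    intro j hj
    by_cases h : c (x j) = y j
    · simp [s, t, hj, h]
    · simpa [s, t, hj, h] using (hc j hj).resolve_left h
  have hst : ∀ K j, s(s K j, t K j) = s(x j, y j) := by
    intro K j
    by_cases h : j ∈ K <;> simp [s, t, h, Sym2.eq_swap]
  have hprod : ∏ j ∈ J, 2 * choiceProb n (x j) (y j) =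
      ∑ K ∈ J.powerset, ∏ j ∈ J, choiceProb n (s K j) (t K j) := by
    have h2 : ∀ j, 2 * choiceProb n (x j) (y j) =
        choiceProb n (x j) (y j) + choiceProb n (y j) (x j) := fun j => by
      rw [choiceProb_comm hn (y j), two_mul]
    simp_rw [h2]
    rw [Finset.prod_add]
    refine Finset.sum_congr rfl fun K hK => ?_
    rw [← Finset.prod_sdiff (Finset.mem_powerset.1 hK), mul_comm]
    congr 1
    · refine Finset.prod_congr rfl fun j hj => ?_
      simp [s, t, (Finset.mem_sdiff.1 hj).2]
    · refine Finset.prod_congr rfl fun j hj => ?_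
      simp [s, t, hj]
  rw [hprod]
  refine (measureReal_mono hsub (measure_ne_top _ _)).trans
    ((measureReal_biUnion_finset_le _ _).trans ?_)
  refine Finset.sum_le_sum fun K _ => choicesLaw_real_forall_eq_le hn J _ _ ?_
  intro i hi j hj hij
  refine hinj hi hj ?_
  simp only [Prod.mk.injEq] at hij
  change s(x i, y i) = s(x j, y j)
  rw [← hst K i, ← hst K j, hij.1, hij.2]

end Probability

/-! ### Extra four-cycles -/

section ExtraCycles

variable {n : ℕ}

theorem smallWorld_adj {c : Vertex n → Vertex n} {x y : Vertex n} (h : (smallWorld n c).Adj x y)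
    (h' : ¬(torus n).Adj x y) : c x = y ∨ c y = x := by
  simp only [smallWorld, SimpleGraph.sup_adj, SimpleGraph.fromRel_adj] at h
  tauto

open Classical in
/-- A bound for the probability that the small world graph contains the edge `{x, y}`: torus edges
are always there, and either endpoint may choose the other. -/
noncomputable def edgeWeight (n : ℕ) (x y : Vertex n) : ℝ :=
  (if (torus n).Adj x y then 1 else 0) + 2 * choiceProb n x y

theorem edgeWeight_nonneg (x y : Vertex n) : 0 ≤ edgeWeight n x y := by
  have := choiceProb_nonneg x y
  rw [edgeWeight]
  split_ifs <;> positivity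

variable [NeZero n]

theorem edgeWeight_comm (hn : 3 ≤ n) (x y : Vertex n) : edgeWeight n x y = edgeWeight n y x := by
  rw [edgeWeight, edgeWeight, choiceProb_comm hn x y]
  by_cases h : (torus n).Adj x y
  · simp [h, h.symm]
  · have h' : ¬(torus n).Adj y x := fun h' => h h'.symm
    simp [h, h']

theorem sum_edgeWeight_right (hn : 3 ≤ n) (x : Vertex n) : ∑ y, edgeWeight n x y = 6 := by
  classical
  simp only [edgeWeight, Finset.sum_add_distrib, ← Finset.mul_sum, sum_choiceProb hn]
  rw [Finset.sum_boole, card_torus_neighbors hn]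
  norm_num

theorem sum_edgeWeight_left (hn : 3 ≤ n) (y : Vertex n) : ∑ x, edgeWeight n x y = 6 := by
  simp_rw [edgeWeight_comm hn _ y]
  exact sum_edgeWeight_right hn y

/-- A fixed four-cycle that is not in the torus has a long-range edge `i`, which costs a factor
`O(1 / log n)`; each of the other edges costs its weight. -/
theorem choicesLaw_real_isFourCycle_le (hn : 3 ≤ n) (u a b d : Vertex n) :
    (choicesLaw n).real
        {c | IsFourCycle (smallWorld n c) u a b d ∧ ¬IsFourCycle (torus n) u a b d} ≤
      ∑ i : Fin 4, 8 / Real.log n *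
        ∏ j ∈ Finset.univ.erase i, edgeWeight n (![u, a, b, d] j) (![a, b, d, u] j) := by
  classical
  have := isProbabilityMeasure_choicesLaw hn
  have hlog : 0 < Real.log n := Real.log_pos (by exact_mod_cast (by omega : 1 < n))
  have hnonneg : ∀ i : Fin 4, 0 ≤ 8 / Real.log n *
      ∏ j ∈ Finset.univ.erase i, edgeWeight n (![u, a, b, d] j) (![a, b, d, u] j) := fun i =>
    mul_nonneg (by positivity) (Finset.prod_nonneg fun j _ => edgeWeight_nonneg _ _)
  rcases Set.eq_empty_or_nonempty {c | IsFourCycle (smallWorld n c) u a b d ∧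
    ¬IsFourCycle (torus n) u a b d} with h | ⟨c₀, hc₀, hT⟩
  · rw [h, measureReal_empty]
    exact Finset.sum_nonneg fun i _ => hnonneg i
  obtain ⟨h1, h2, h3, h4, h5, h6, -⟩ := hc₀
  set x := ![u, a, b, d] with hx
  set y := ![a, b, d, u] with hy
  have hinj : Function.Injective fun j => s(x j, y j) := by
    intro i j hij
    fin_cases i <;> fin_cases j <;>
      simp [hx, hy, h1, h2, h3, h4, h5, h6, h1.symm, h2.symm, h3.symm, h4.symm, h5.symm,
        h6.symm] at hij ⊢
  obtain ⟨i, hi⟩ : ∃ i, ¬(torus n).Adj (x i) (y i) := by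
    by_contra hall
    push Not at hall
    exact hT ⟨h1, h2, h3, h4, h5, h6, hall 0, hall 1, hall 2, hall 3⟩
  set J := Finset.univ.filter fun j => ¬(torus n).Adj (x j) (y j) with hJ
  have hiJ : i ∈ J := by simpa [hJ] using hi
  refine le_trans ?_ (Finset.single_le_sum (fun i _ => hnonneg i) (Finset.mem_univ i))
  calc _ ≤ (choicesLaw n).real {c | ∀ j ∈ J, c (x j) = y j ∨ c (y j) = x j} := by
        refine measureReal_mono fun c hc j hj => ?_
        refine smallWorld_adj ?_ (Finset.mem_filter.1 hj).2
        obtain ⟨⟨-, -, -, -, -, -, e0, e1, e2, e3⟩, -⟩ := hc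
        fin_cases j
        · exact e0
        · exact e1
        · exact e2
        · exact e3
    _ ≤ ∏ j ∈ J, 2 * choiceProb n (x j) (y j) :=
        choicesLaw_real_joined_le hn J x y hinj.injOn
    _ = 2 * choiceProb n (x i) (y i) * ∏ j ∈ J.erase i, 2 * choiceProb n (x j) (y j) :=
        (Finset.mul_prod_erase _ _ hiJ).symm
    _ ≤ 8 / Real.log n * ∏ j ∈ Finset.univ.erase i, edgeWeight n (x j) (y j) := by
        refine mul_le_mul ?_ ?_ (Finset.prod_nonneg fun j _ => ?_) (by positivity)
        · have := choiceProb_le hn (x i) (y i)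
          calc _ ≤ 2 * (4 / Real.log n) := by gcongr
            _ = _ := by ring
        · rw [hJ, ← Finset.filter_erase, Finset.prod_filter]
          refine Finset.prod_le_prod (fun j _ => ?_) fun j _ => ?_
          · have := choiceProb_nonneg (x j) (y j)
            split_ifs <;> positivity
          · have := choiceProb_nonneg (x j) (y j)
            rw [edgeWeight]
            split_ifs <;> first | contradiction | linarith
        · have := choiceProb_nonneg (x j) (y j)
          positivity

/-- Deleting any one edge of the cycle leaves paths from the root, along which the weights sum to
`6 ^ 3`. -/
theorem sum_prod_edgeWeight (hn : 3 ≤ n) (u : Vertex n) (i : Fin 4) :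
    ∑ a, ∑ b, ∑ d, ∏ j ∈ Finset.univ.erase i,
      edgeWeight n (![u, a, b, d] j) (![a, b, d, u] j) = 216 := by
  -- in each case the sums are ordered so that the innermost variable is an end of a path
  have hl := sum_edgeWeight_left hn
  have hr := sum_edgeWeight_right hn
  have e0 : Finset.univ.erase (0 : Fin 4) = {1, 2, 3} := by decide
  have e1 : Finset.univ.erase (1 : Fin 4) = {0, 2, 3} := by decide
  have e2 : Finset.univ.erase (2 : Fin 4) = {0, 1, 3} := by decide
  have e3 : Finset.univ.erase (3 : Fin 4) = {0, 1, 2} := by decide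
  fin_cases i
  · have h : ∀ a b d, ∏ j ∈ Finset.univ.erase (0 : Fin 4),
        edgeWeight n (![u, a, b, d] j) (![a, b, d, u] j) =
          edgeWeight n a b * (edgeWeight n b d * edgeWeight n d u) := fun a b d => by
      simp [e0]
    simp only [Fin.zero_eta, h]
    calc _ = ∑ b, ∑ d, ∑ a, edgeWeight n a b * (edgeWeight n b d * edgeWeight n d u) := by
          rw [Finset.sum_comm]
          exact Finset.sum_congr rfl fun b _ => Finset.sum_comm
      _ = ∑ d, ∑ b, ∑ a, edgeWeight n a b * (edgeWeight n b d * edgeWeight n d u) :=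
          Finset.sum_comm
      _ = 216 := by
          simp only [← Finset.sum_mul, ← Finset.mul_sum, hl]
          norm_num
  · have h : ∀ a b d, ∏ j ∈ Finset.univ.erase (1 : Fin 4),
        edgeWeight n (![u, a, b, d] j) (![a, b, d, u] j) =
          edgeWeight n u a * (edgeWeight n b d * edgeWeight n d u) := fun a b d => by
      simp [e1]
    simp only [Fin.mk_one, h]
    calc _ = ∑ a, ∑ d, ∑ b, edgeWeight n u a * (edgeWeight n b d * edgeWeight n d u) :=
          Finset.sum_congr rfl fun a _ => Finset.sum_comm
      _ = 216 := by
          simp only [← Finset.sum_mul, ← Finset.mul_sum, hl, hr]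
          norm_num
  · have h : ∀ a b d, ∏ j ∈ Finset.univ.erase (2 : Fin 4),
        edgeWeight n (![u, a, b, d] j) (![a, b, d, u] j) =
          edgeWeight n u a * (edgeWeight n a b * edgeWeight n d u) := fun a b d => by
      simp [e2]
    simp only [Fin.reduceFinMk, h, ← Finset.sum_mul, ← Finset.mul_sum, hl, hr]
    norm_num
  · have h : ∀ a b d, ∏ j ∈ Finset.univ.erase (3 : Fin 4),
        edgeWeight n (![u, a, b, d] j) (![a, b, d, u] j) =
          edgeWeight n u a * (edgeWeight n a b * edgeWeight n b d) := fun a b d => by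
      simp [e3]
    simp only [Fin.reduceFinMk, h, ← Finset.sum_mul, ← Finset.mul_sum, hr]
    norm_num

/-- The constant is `4 * 8 * 6 ^ 3`: four positions of a long-range edge, each of probability at
most `2 * (4 / log n)`, and the total weight `6 ^ 3` of the other three edges. -/
theorem choicesLaw_real_extraCycleEvent_le (hn : 3 ≤ n) (u : Vertex n) :
    (choicesLaw n).real (extraCycleEvent n u) ≤ 6912 / Real.log n := by
  have := isProbabilityMeasure_choicesLaw hn
  have hset : extraCycleEvent n u = ⋃ t : Vertex n × Vertex n × Vertex n,
      {c | IsFourCycle (smallWorld n c) u t.1 t.2.1 t.2.2 ∧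
        ¬IsFourCycle (torus n) u t.1 t.2.1 t.2.2} := by
    ext c
    simp [extraCycleEvent]
  rw [hset]
  refine (measureReal_iUnion_fintype_le _).trans ((Finset.sum_le_sum fun t _ =>
    choicesLaw_real_isFourCycle_le hn u t.1 t.2.1 t.2.2).trans (le_of_eq ?_))
  have htriple : ∀ f : Vertex n × Vertex n × Vertex n → ℝ,
      ∑ t, f t = ∑ a, ∑ b, ∑ d, f (a, b, d) := fun f => by
    rw [Fintype.sum_prod_type]
    exact Finset.sum_congr rfl fun a _ => Fintype.sum_prod_type _
  rw [Finset.sum_comm]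
  simp only [← Finset.mul_sum, htriple, sum_prod_edgeWeight hn]
  rw [Finset.sum_const, Finset.card_univ, Fintype.card_fin]
  ring

/-! ### The expected number of detected vertices -/

theorem one_sub_le_choicesLaw_real_detectedEvent (hn : 3 ≤ n) (u : Vertex n) :
    1 - (choicesLaw n).real (extraCycleEvent n u) ≤
      (choicesLaw n).real (detectedEvent n u) := by
  have := isProbabilityMeasure_choicesLaw hn
  rw [← probReal_compl_eq_one_sub (MeasurableSet.of_discrete)]
  exact measureReal_mono (compl_extraCycleEvent_subset_detectedEvent hn u)

theorem integral_detectedCount (hn : 3 ≤ n) :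
    ∫ c, (detectedCount n c : ℝ) ∂(choicesLaw n) =
      ∑ u, (choicesLaw n).real (detectedEvent n u) := by
  classical
  have := isProbabilityMeasure_choicesLaw hn
  have h : ∀ c, (detectedCount n c : ℝ) = ∑ u, (detectedEvent n u).indicator 1 c := by
    intro c
    rw [detectedCount, Set.ncard_eq_toFinset_card']
    simp [Set.indicator_apply, detectedEvent, Finset.sum_boole]
  simp_rw [h]
  rw [integral_finsetSum _ fun u _ => Integrable.of_finite]
  refine Finset.sum_congr rfl fun u _ => ?_
  exact integral_indicator_one MeasurableSet.of_discrete

end ExtraCycles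

end UTSW

theorem mainTheorem4 :
    -- the edges kept at a detected vertex are exactly its torus edges
    (∀ n : ℕ, 3 ≤ n → ∀ (c : UTSW.Vertex n → UTSW.Vertex n) (u : UTSW.Vertex n),
      (UTSW.removeLongRangeEdges (UTSW.smallWorld n c)).detected u →
      ∀ v, (UTSW.removeLongRangeEdges (UTSW.smallWorld n c)).graph.Adj u v ↔
        (UTSW.torus n).Adj u v) ∧
    -- `Pr(D_u) ≥ 1 - 4 Pr(E_u)`
    (∀ n : ℕ, 3 ≤ n → ∀ u : UTSW.Vertex n,
      1 - 4 * (UTSW.choicesLaw n).real (UTSW.extraCycleEvent n u) ≤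
        (UTSW.choicesLaw n).real (UTSW.detectedEvent n u)) ∧
    -- the expected number of detected vertices is `|V| (1 - O(1 / log n))`
    (∃ K : ℝ, 0 < K ∧ ∀ n : ℕ, 3 ≤ n →
      (Fintype.card (UTSW.Vertex n) : ℝ) * (1 - K / Real.log n) ≤
          ∫ c, (UTSW.detectedCount n c : ℝ) ∂(UTSW.choicesLaw n) ∧
        ∫ c, (UTSW.detectedCount n c : ℝ) ∂(UTSW.choicesLaw n) ≤
          (Fintype.card (UTSW.Vertex n) : ℝ)) := by
  refine ⟨fun n hn c u hu v => ?_, fun n hn u => ?_, 6912, by norm_num, fun n hn => ?_⟩ <;>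
    have : NeZero n := ⟨by omega⟩
  · exact UTSW.removeLongRangeEdges_adj_iff hn le_sup_left hu v
  · have h := UTSW.one_sub_le_choicesLaw_real_detectedEvent hn u
    have h0 : 0 ≤ (UTSW.choicesLaw n).real (UTSW.extraCycleEvent n u) := measureReal_nonneg
    linarith
  · have := UTSW.isProbabilityMeasure_choicesLaw hn
    rw [UTSW.integral_detectedCount hn, ← nsmul_eq_mul, ← Finset.card_univ]
    refine ⟨Finset.card_nsmul_le_sum _ _ _ fun u _ => ?_, ?_⟩
    · have h := UTSW.one_sub_le_choicesLaw_real_detectedEvent hn u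
      have h' := UTSW.choicesLaw_real_extraCycleEvent_le hn u
      linarith
    · refine (Finset.sum_le_card_nsmul _ _ 1 fun u _ => measureReal_le_one).trans ?_
      simp
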